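/- All manifolds are real, smooth, Hausdorff and second countable, and all maps and structures are smooth. Let $m\ge 1$, let $M$ be an $m$-dimensional manifold with a volume form $\eta$ (a nowhere vanishing $m$-form), let $\kappa\colon\mathcal M\to M$ be a fibre bundle with $\dim\mathcal M=n+m$, put $\omega=\kappa^*\eta$, and let $\Omega\in\Omega^{m+1}(\mathcal M)$ be a closed form, i.e. $(\mathcal M,\Omega,\omega)$ is a (pre)multisymplectic system. For an $m$-multivector field $\mathbf X\in\mathfrak X^m(\mathcal M)$ (a section of $\Lambda^m T\mathcal M$) let $i(\mathbf X)\Omega$ be the contraction, determined by $i(X_1\wedge\dots\wedge X_m)\Omega=i(X_1)\cdots i(X_m)\Omega$. A non-vanishing, locally decomposable $\mathbf X$ (locally $\mathbf X=X_1\wedge\dots\wedge X_m$ for vector fields $X_i$) has an associated $m$-dimensional distribution $\mathcal D(\mathbf X)$, such that $\mathbf X$ is a section of $\Lambda^m\mathcal D(\mathbf X)$; $\mathbf X$ is *integrable* if it is non-vanishing and locally decomposable and through each point of $\mathcal M$ there passes an integral submanifold of $\mathbf X$, that is, an immersed $m$-dimensional submanifold $j\colon S\hookrightarrow\mathcal M$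 (an injective immersion) with $T_sj(T_sS)=\mathcal D_{j(s)}(\mathbf X)$ for all $s\in S$. Let $$\ker^m\Omega=\{\mathbf X\in\mathfrak X^m(\mathcal M): i(\mathbf X)\Omega=0\},$$ $$\ker^m_{\omega(I)}\Omega=\{\mathbf X\in\ker^m\Omega:\ i(\mathbf X)\omega\text{ vanishes nowhere and }\mathbf X\text{ is integrable}\}.$$ For $U\subseteq M$ open, a local section $\psi\colon U\to\mathcal M$ of $\kappa$ is an *integral section* of $\mathbf X$ if $T_x\psi(T_xM)=\mathcal D_{\psi(x)}(\mathbf X)$ for all $x\in U$; it is a *solution section* if it is an integral section of some $\mathbf X\in\ker^m_{\omega(I)}\Omega$. **Theorem.** Let $\Phi\colon\mathcal M\to\mathcal M$ be a symmetry of $(\mathcal M,\Omega,\omega)$, i.e. a diffeomorphism with $\Phi_*(\ker^m\Omega)\subseteq\ker^m\Omega$. 1. If $\mathbf X\in\ker^m\Omega$ is integrable, then $\Phi_*\mathbf X\in\ker^m\Omega$ is integrable, and $\Phi$ transforms integral submanifolds of $\mathbf X$ into integral submanifolds of $\Phi_*\mathbf X$: if $j\colon S\hookrightarrow\mathcal M$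 is an integral submanifold of $\mathbf X$, then $\Phi\circ j$ is an integral submanifold of $\Phi_*\mathbf X$. 2. Suppose that moreover $\varphi\circ\kappa=\kappa\circ\Phi$ for a diffeomorphism $\varphi\colon M\to M$. Then, for every $\mathbf X\in\ker^m_{\omega(I)}\Omega$, we have $\Phi_*\mathbf X\in\ker^m_{\omega(I)}\Omega$, and for every integral section $\psi\colon U\to\mathcal M$ of $\mathbf X$ the map $\Phi\circ\psi\circ\varphi^{-1}\colon\varphi(U)\to\mathcal M$ is an integral section of $\Phi_*\mathbf X$. Hence $\Phi$ maps solution sections $\psi\colon U\to\mathcal M$ to solution sections $\Phi\circ\psi\circ\varphi^{-1}\colon\varphi(U)\to\mathcal M$. -/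

import Mathlib

open Set Function Topology
open scoped Manifold ContDiff

universe u

namespace Multisymplectic

noncomputable section

/-! ### Contraction of multivectors with forms (linear algebra) -/

section Algebra

variable {V : Type*} [AddCommGroup V] [Module ℝ V] {m : ℕ}

/-- The contraction `i(X)α` of an `m`-vector with an `m`-form: the linear extension of
`i(X₁ ∧ … ∧ Xₘ)α = i(X₁) … i(Xₘ)α = α(Xₘ, …, X₁)`. -/
def contractTop (α : V [⋀^Fin m]→ₗ[ℝ] ℝ) (X : ⋀[ℝ]^m V) : ℝ :=
  exteriorPower.alternatingMapLinearEquiv (α.domDomCongr Fin.revPerm) X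

theorem contractTop_ιMulti (α : V [⋀^Fin m]→ₗ[ℝ] ℝ) (v : Fin m → V) :
    contractTop α (exteriorPower.ιMulti ℝ m v) = α (fun i => v i.rev) := by
  simp only [contractTop, exteriorPower.alternatingMapLinearEquiv_apply_ιMulti,
    AlternatingMap.domDomCongr_apply]
  rfl

/-- The contraction `i(X)α` of an `m`-vector with an `(m+1)`-form, a linear form: the linear
extension of `i(X₁ ∧ … ∧ Xₘ)α = i(X₁) … i(Xₘ)α = α(Xₘ, …, X₁, ·)`. -/
def contract (α : V [⋀^Fin (m + 1)]→ₗ[ℝ] ℝ) (X : ⋀[ℝ]^m V) : V →ₗ[ℝ] ℝ where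
  toFun w := exteriorPower.alternatingMapLinearEquiv
    ((α.domDomCongr Fin.revPerm).curryLeft w) X
  map_add' w w' := by simp
  map_smul' c w := by simp

theorem contract_ιMulti (α : V [⋀^Fin (m + 1)]→ₗ[ℝ] ℝ) (v : Fin m → V) (w : V) :
    contract α (exteriorPower.ιMulti ℝ m v) w =
      α (Fin.snoc (α := fun _ => V) (fun i => v i.rev) w) := by
  simp only [contract, LinearMap.coe_mk, AddHom.coe_mk,
    exteriorPower.alternatingMapLinearEquiv_apply_ιMulti, AlternatingMap.curryLeft_apply_apply,
    AlternatingMap.domDomCongr_apply]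
  congr 1
  funext i
  refine Fin.lastCases ?_ (fun j => ?_) i
  · simp [Matrix.vecCons]
  · simp [Matrix.vecCons, Fin.rev_castSucc]

end Algebra

/-! ### Differential forms on manifolds -/

section Forms

variable {d : ℕ} {N : Type*} [TopologicalSpace N] [ChartedSpace (EuclideanSpace ℝ (Fin d)) N]

variable (d N) in
/-- (Not necessarily smooth) differential `k`-forms on a `d`-dimensional manifold. -/
abbrev Form (k : ℕ) : Type _ := ∀ p : N, TangentSpace (𝓡 d) p [⋀^Fin k]→L[ℝ] ℝ

/-- The coordinate expression of a form in the chart at `p₀`: the pullback by the inverse chart. -/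
def Form.inChart {k : ℕ} (α : Form d N k) (p₀ : N) (y : EuclideanSpace ℝ (Fin d)) :
    EuclideanSpace ℝ (Fin d) [⋀^Fin k]→L[ℝ] ℝ :=
  (α ((extChartAt (𝓡 d) p₀).symm y)).compContinuousLinearMap
    (mfderiv 𝓘(ℝ, EuclideanSpace ℝ (Fin d)) (𝓡 d) (extChartAt (𝓡 d) p₀).symm y)

/-- A form is smooth if its coordinate expressions are. -/
def Form.IsSmooth {k : ℕ} (α : Form d N k) : Prop :=
  ∀ p₀ : N, ContDiffOn ℝ ∞ (α.inChart p₀) (extChartAt (𝓡 d) p₀).target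

/-- A form is closed if its exterior derivative vanishes in charts. -/
def Form.IsClosed {k : ℕ} (α : Form d N k) : Prop :=
  ∀ p₀ : N, ∀ y ∈ (extChartAt (𝓡 d) p₀).target, extDeriv (α.inChart p₀) y = 0

/-- A volume form on a `d`-dimensional manifold: a smooth nowhere vanishing `d`-form. -/
structure IsVolumeForm (η : Form d N d) : Prop where
  smooth : η.IsSmooth
  ne_zero : ∀ p, η p ≠ 0

/-- The pullback `κ^* α` of a form. -/
def Form.pullback {d' : ℕ} {N' : Type*} [TopologicalSpace N']
    [ChartedSpace (EuclideanSpace ℝ (Fin d')) N'] {k : ℕ} (κ : N' → N) (α : Form d N k) :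
    Form d' N' k :=
  fun p => (α (κ p)).compContinuousLinearMap (mfderiv (𝓡 d') (𝓡 d) κ p)

end Forms

/-! ### Multivector fields -/

section MultivectorFields

variable {d : ℕ} {N : Type u} [TopologicalSpace N] [ChartedSpace (EuclideanSpace ℝ (Fin d)) N]
  [IsManifold (𝓡 d) ∞ N]

variable (d N) in
/-- (Not necessarily smooth) `m`-multivector fields: sections of `Λ^m TN`. -/
abbrev MVField (m : ℕ) : Type _ := ∀ p : N, ⋀[ℝ]^m (TangentSpace (𝓡 d) p)

variable {m : ℕ}

/-- A multivector field is smooth if its components in charts are smooth functions: for each chart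
`x` and each constant-coefficient `m`-form `α` on `ℝ^d`, the function `p ↦ α(Λ^m(T_p x) X_p)` is
smooth on the domain of `x`. -/
def MVField.IsSmooth (X : MVField d N m) : Prop :=
  ∀ (p₀ : N) (α : EuclideanSpace ℝ (Fin d) [⋀^Fin m]→ₗ[ℝ] ℝ),
    ContMDiffOn (𝓡 d) 𝓘(ℝ, ℝ) ∞
      (fun p => exteriorPower.alternatingMapLinearEquiv α
        (exteriorPower.map m
          (mfderiv (𝓡 d) 𝓘(ℝ, EuclideanSpace ℝ (Fin d)) (extChartAt (𝓡 d) p₀) p :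
            TangentSpace (𝓡 d) p →L[ℝ] EuclideanSpace ℝ (Fin d)).toLinearMap (X p)))
      (chartAt (EuclideanSpace ℝ (Fin d)) p₀).source

/-- The push-forward `(Φ_* X)_q = Λ^m(TΦ) X_{Φ⁻¹(q)}` of a multivector field by a
diffeomorphism. -/
def MVField.pushforward (Φ : Diffeomorph (𝓡 d) (𝓡 d) N N ∞) (X : MVField d N m) :
    MVField d N m := fun q =>
  exteriorPower.map m
    (mfderiv (𝓡 d) (𝓡 d) Φ (Φ.symm q) :
      TangentSpace (𝓡 d) (Φ.symm q) →L[ℝ] TangentSpace (𝓡 d) q).toLinearMap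
    (X (Φ.symm q))

/-- Local decomposability: around each point `X = X₁ ∧ … ∧ Xₘ` for smooth local vector fields. -/
def MVField.IsLocallyDecomposable (X : MVField d N m) : Prop :=
  ∀ p : N, ∃ U : Set N, IsOpen U ∧ p ∈ U ∧
    ∃ Y : Fin m → ∀ q : N, TangentSpace (𝓡 d) q,
      (∀ i, ContMDiffOn (𝓡 d) (𝓡 d).tangent ∞
        (fun q => (⟨q, Y i q⟩ : TangentBundle (𝓡 d) N)) U) ∧
      ∀ q ∈ U, X q = exteriorPower.ιMulti ℝ m (fun i => Y i q)

/-- The distribution `D` is `m`-dimensional and associated with `X`: `X` is a section of `Λ^m D`.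
A non-vanishing locally decomposable `X` has exactly one such `D`. -/
def MVField.IsAssociated (X : MVField d N m)
    (D : ∀ p : N, Submodule ℝ (TangentSpace (𝓡 d) p)) : Prop :=
  ∀ p, Module.finrank ℝ (D p) = m ∧
    X p ∈ LinearMap.range (exteriorPower.map m (D p).subtype)

/-- The (immersed) submanifold of `N` given by the injective immersion `j : S → N` is an integral
submanifold of the distribution `D`: its tangent spaces are the spaces of `D`. -/
structure IsIntegralSubmanifoldOf (m : ℕ) (D : ∀ p : N, Submodule ℝ (TangentSpace (𝓡 d) p))
    {S : Type*} [TopologicalSpace S] [ChartedSpace (EuclideanSpace ℝ (Fin m)) S]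
    (j : S → N) : Prop where
  smooth : ContMDiff (𝓡 m) (𝓡 d) ∞ j
  injective : Injective j
  immersion : ∀ s, Injective (mfderiv (𝓡 m) (𝓡 d) j s)
  tangent : ∀ s, LinearMap.range (mfderiv (𝓡 m) (𝓡 d) j s :
    TangentSpace (𝓡 m) s →ₗ[ℝ] TangentSpace (𝓡 d) (j s)) = D (j s)

/-- A distribution of dimension `m` is integrable if through each point there passes an integral
submanifold. -/
def IsIntegrableDistribution (m : ℕ)
    (D : ∀ p : N, Submodule ℝ (TangentSpace (𝓡 d) p)) : Prop :=
  ∀ p : N, ∃ (S : Type u) (_ : TopologicalSpace S)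
    (_ : ChartedSpace (EuclideanSpace ℝ (Fin m)) S) (_ : IsManifold (𝓡 m) ∞ S)
    (_ : T2Space S) (_ : SecondCountableTopology S) (j : S → N),
    IsIntegralSubmanifoldOf m D j ∧ p ∈ range j

/-- Integrability of a multivector field: it is non-vanishing and locally decomposable, and its
associated distribution is integrable. -/
structure MVField.IsIntegrable (X : MVField d N m) : Prop where
  ne_zero : ∀ p, X p ≠ 0
  decomposable : X.IsLocallyDecomposable
  integrable : ∃ D, X.IsAssociated D ∧ IsIntegrableDistribution m D

/-- Integral submanifolds of a (non-vanishing, locally decomposable) multivector field: those of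
its associated distribution. -/
def MVField.IsIntegralSubmanifold (X : MVField d N m)
    {S : Type*} [TopologicalSpace S] [ChartedSpace (EuclideanSpace ℝ (Fin m)) S]
    (j : S → N) : Prop :=
  ∃ D, X.IsAssociated D ∧ IsIntegralSubmanifoldOf m D j

/-- `ker^m Ω`: the smooth `m`-multivector fields with `i(X)Ω = 0`. -/
def kerMV (Ω : Form d N (m + 1)) : Set (MVField d N m) :=
  {X | X.IsSmooth ∧ ∀ p, contract (Ω p).toAlternatingMap (X p) = 0}

/-- `ker^m_{vol(I)} Ω`: the integrable `X` in `ker^m Ω` with `i(X)vol` nowhere zero. -/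
def kerMVIntegrable (Ω : Form d N (m + 1)) (vol : Form d N m) : Set (MVField d N m) :=
  {X | X ∈ kerMV Ω ∧ (∀ p, contractTop (vol p).toAlternatingMap (X p) ≠ 0) ∧ X.IsIntegrable}

/-- `Φ` is a symmetry: `Φ_*(ker^m Ω) ⊆ ker^m Ω`. -/
def IsSymmetry (Ω : Form d N (m + 1)) (Φ : Diffeomorph (𝓡 d) (𝓡 d) N N ∞) : Prop :=
  MVField.pushforward (m := m) Φ '' kerMV Ω ⊆ kerMV Ω

end MultivectorFields

/-! ### (Pre)multisymplectic systems and sections -/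

section Systems

variable {m d : ℕ} {B : Type*} [TopologicalSpace B] [ChartedSpace (EuclideanSpace ℝ (Fin m)) B]
  {N : Type u} [TopologicalSpace N] [ChartedSpace (EuclideanSpace ℝ (Fin d)) N]
  [IsManifold (𝓡 d) ∞ N]

/-- `κ : N → B` is a smooth fibre bundle with standard fibre `F` (an `n`-manifold). -/
structure IsSmoothFiberBundle {n : ℕ} (F : Type*) [TopologicalSpace F]
    [ChartedSpace (EuclideanSpace ℝ (Fin n)) F] (κ : N → B) : Prop where
  surjective : Surjective κ
  smooth : ContMDiff (𝓡 d) (𝓡 m) ∞ κ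
  locally_trivial : ∀ b : B, ∃ e : Bundle.Trivialization F κ, b ∈ e.baseSet ∧
    ContMDiffOn (𝓡 d) ((𝓡 m).prod (𝓡 n)) ∞ e e.source ∧
    ContMDiffOn ((𝓡 m).prod (𝓡 n)) (𝓡 d) ∞ e.toOpenPartialHomeomorph.symm e.target

/-- A (pre)multisymplectic form of degree `m + 1`: a smooth closed form (no nondegeneracy). -/
structure IsPremultisymplecticForm (Ω : Form d N (m + 1)) : Prop where
  smooth : Ω.IsSmooth
  closed : Ω.IsClosed

/-- `ψ : U ⊆ B → N` is a (local) section of `κ` which is an integral section of the multivector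
field `X`: at each point of its image, the tangent space of the image is the space of the
distribution associated with `X`. -/
def IsIntegralSection (κ : N → B) (X : MVField d N m) (U : Set B) (ψ : B → N) : Prop :=
  IsOpen U ∧ ContMDiffOn (𝓡 m) (𝓡 d) ∞ ψ U ∧ (∀ x ∈ U, κ (ψ x) = x) ∧
    ∃ D, X.IsAssociated D ∧ ∀ x ∈ U,
      LinearMap.range (mfderiv (𝓡 m) (𝓡 d) ψ x :
        TangentSpace (𝓡 m) x →ₗ[ℝ] TangentSpace (𝓡 d) (ψ x)) = D (ψ x)

/-- Solution sections of the system: (local) sections of `κ` which are integral sections of some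
multivector field in `ker^m_{vol(I)} Ω`. -/
def IsSolutionSection (κ : N → B) (Ω : Form d N (m + 1)) (vol : Form d N m) (U : Set B)
    (ψ : B → N) : Prop :=
  ∃ X ∈ kerMVIntegrable Ω vol, IsIntegralSection κ X U ψ

end Systems

end

end Multisymplectic

namespace Multisymplectic

/-! ### Linear maps acting on multivectors and top-degree forms -/

section LinearAlgebra

variable {V W : Type*} [AddCommGroup V] [Module ℝ V] [AddCommGroup W] [Module ℝ W] {m : ℕ}

/-! All the notions involved are natural under diffeomorphisms. If `D` is associated with `X`, then
`TΦ(D)` is associated with `Φ_*X` by functoriality of `Λ^m`, and the chain rule carries integral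
submanifolds and integral sections of `D` to those of `TΦ(D)`. Membership in `ker^m Ω` is preserved
by the symmetry hypothesis itself.

The one point that is not formal is that `i(Φ_*X)ω` vanishes nowhere, since `Φ` need not preserve `ω
= κ^*η`. From `φ ∘ κ = κ ∘ Φ` one gets `Φ^*ω = κ^*(φ^*η)`, and `φ^*η` is a nowhere zero form of top
degree, hence at each point a nonzero multiple of `η`. The pointwise content of this is
`alternatingMap_ne_zero_of_ne_zero`; `contractTop_pullback_pushforward_ne_zero` applies it. -/

theorem map_mem_range_exteriorPower_map (f : V →ₗ[ℝ] W) (D : Submodule ℝ V) {x : ⋀[ℝ]^m V}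
    (hx : x ∈ LinearMap.range (exteriorPower.map m D.subtype)) :
    exteriorPower.map m f x ∈ LinearMap.range (exteriorPower.map m (D.map f).subtype) := by
  obtain ⟨y, rfl⟩ := hx
  refine ⟨exteriorPower.map m (f.restrict fun v hv => Submodule.mem_map_of_mem hv) y, ?_⟩
  -- `Λ^m` is applied to the commuting square formed by `f`, its restriction `D → f(D)` and the two
  -- inclusions.
  rw [← LinearMap.comp_apply, ← LinearMap.comp_apply, ← exteriorPower.map_comp,
    ← exteriorPower.map_comp]
  rfl

/-- If a top-degree form does not vanish on a tuple `v`, then no nonzero top-degree form vanishes on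
the image of `v` under a linear isomorphism. -/
theorem alternatingMap_ne_zero_of_ne_zero (hV : Module.finrank ℝ V = m)
    (hW : Module.finrank ℝ W = m) (f : V ≃ₗ[ℝ] W) {α : V [⋀^Fin m]→ₗ[ℝ] ℝ}
    {β : W [⋀^Fin m]→ₗ[ℝ] ℝ} (hβ : β ≠ 0) {v : Fin m → V} (hv : α v ≠ 0) :
    β (fun i => f (v i)) ≠ 0 := by
  have hli : LinearIndependent ℝ v := by
    by_contra h
    exact hv (α.map_linearDependent v h)
  have hli' : LinearIndependent ℝ (fun i => f (v i)) :=
    hli.map' f.toLinearMap f.ker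
  intro h0
  -- Independent vectors, as many as the dimension, form a basis, and an alternating form of that
  -- degree is determined by its value there. The basis constructor needs a nonempty index type; in
  -- degree 0 there is only one tuple to test.
  rcases Nat.eq_zero_or_pos m with rfl | hm
  · refine hβ ?_
    ext w
    rw [Subsingleton.elim w fun i => f (v i)]
    exact h0
  · have : Nonempty (Fin m) := ⟨⟨0, hm⟩⟩
    have hb := coe_basisOfLinearIndependentOfCardEqFinrank hli' (by simp [hW])
    refine hβ ((β.map_basis_eq_zero_iff
      (basisOfLinearIndependentOfCardEqFinrank hli' (by simp [hW]))).1 ?_)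
    rw [hb]
    exact h0

end LinearAlgebra

/-! ### Naturality under a diffeomorphism -/

section Pushforward

variable {d : ℕ} {N : Type*} [TopologicalSpace N] [ChartedSpace (EuclideanSpace ℝ (Fin d)) N]
  {m : ℕ}

/-- The tangent map of a diffeomorphism at a point, as a linear equivalence. -/
noncomputable def diffeoTangent (Φ : Diffeomorph (𝓡 d) (𝓡 d) N N ∞) (p : N) :
    TangentSpace (𝓡 d) p ≃ₗ[ℝ] TangentSpace (𝓡 d) (Φ p) :=
  (Φ.mfderivToContinuousLinearEquiv (by simp) p).toLinearEquiv

theorem diffeoTangent_toLinearMap (Φ : Diffeomorph (𝓡 d) (𝓡 d) N N ∞) (p : N) :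
    (diffeoTangent Φ p).toLinearMap = (mfderiv (𝓡 d) (𝓡 d) Φ p).toLinearMap := rfl

theorem MVField.pushforward_apply_image (Φ : Diffeomorph (𝓡 d) (𝓡 d) N N ∞) (X : MVField d N m)
    (p : N) :
    X.pushforward Φ (Φ p) = exteriorPower.map m (mfderiv (𝓡 d) (𝓡 d) Φ p).toLinearMap (X p) := by
  -- `Φ.symm (Φ p) = p` is not definitional, so the two sides have different base points. Stating
  -- the equality in the model space, to which every tangent space unfolds, allows substitution of
  -- the point.
  have key : ∀ p' : N, p' = p →
      (exteriorPower.map m (mfderiv (𝓡 d) (𝓡 d) Φ p').toLinearMap (X p') :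
        ⋀[ℝ]^m (EuclideanSpace ℝ (Fin d))) =
      exteriorPower.map m (mfderiv (𝓡 d) (𝓡 d) Φ p).toLinearMap (X p) := by
    rintro _ rfl
    rfl
  exact key _ (Φ.symm_apply_apply p)

/-- The push-forward of a distribution by a diffeomorphism. -/
noncomputable def pushforwardDistribution (Φ : Diffeomorph (𝓡 d) (𝓡 d) N N ∞)
    (D : ∀ p : N, Submodule ℝ (TangentSpace (𝓡 d) p)) (q : N) :
    Submodule ℝ (TangentSpace (𝓡 d) q) :=
  (D (Φ.symm q)).map (mfderiv (𝓡 d) (𝓡 d) Φ (Φ.symm q) :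
    TangentSpace (𝓡 d) (Φ.symm q) →L[ℝ] TangentSpace (𝓡 d) q).toLinearMap

theorem pushforwardDistribution_apply_image (Φ : Diffeomorph (𝓡 d) (𝓡 d) N N ∞)
    (D : ∀ p : N, Submodule ℝ (TangentSpace (𝓡 d) p)) (p : N) :
    pushforwardDistribution Φ D (Φ p) = (D p).map (mfderiv (𝓡 d) (𝓡 d) Φ p).toLinearMap := by
  have key : ∀ p' : N, p' = p →
      ((D p').map (mfderiv (𝓡 d) (𝓡 d) Φ p').toLinearMap :
        Submodule ℝ (EuclideanSpace ℝ (Fin d))) =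
      (D p).map (mfderiv (𝓡 d) (𝓡 d) Φ p).toLinearMap := by
    rintro _ rfl
    rfl
  exact key _ (Φ.symm_apply_apply p)

theorem MVField.IsAssociated.pushforward {X : MVField d N m}
    {D : ∀ p : N, Submodule ℝ (TangentSpace (𝓡 d) p)} (h : X.IsAssociated D)
    (Φ : Diffeomorph (𝓡 d) (𝓡 d) N N ∞) :
    (X.pushforward Φ).IsAssociated (pushforwardDistribution Φ D) := by
  intro q
  obtain ⟨p, rfl⟩ : ∃ p, Φ p = q := ⟨Φ.symm q, Φ.apply_symm_apply q⟩
  rw [MVField.pushforward_apply_image, pushforwardDistribution_apply_image]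
  refine ⟨?_, map_mem_range_exteriorPower_map _ _ (h p).2⟩
  rw [← diffeoTangent_toLinearMap, ← (h p).1]
  exact LinearEquiv.finrank_map_eq (diffeoTangent Φ p) (D p)

/-- `Λ^m(TΦ)` is injective, having `Λ^m` of the inverse tangent map as a left inverse. -/
theorem MVField.pushforward_ne_zero {X : MVField d N m} (hX : ∀ p, X p ≠ 0)
    (Φ : Diffeomorph (𝓡 d) (𝓡 d) N N ∞) (q : N) : X.pushforward Φ q ≠ 0 := by
  obtain ⟨p, rfl⟩ : ∃ p, Φ p = q := ⟨Φ.symm q, Φ.apply_symm_apply q⟩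
  rw [MVField.pushforward_apply_image, ← diffeoTangent_toLinearMap]
  exact (map_ne_zero_iff _ (exteriorPower.map_injective (diffeoTangent Φ p).symm.toLinearMap
    (diffeoTangent Φ p).symm_comp)).2 (hX p)

theorem IsIntegralSubmanifoldOf.pushforward
    {D : ∀ p : N, Submodule ℝ (TangentSpace (𝓡 d) p)}
    {S : Type*} [TopologicalSpace S] [ChartedSpace (EuclideanSpace ℝ (Fin m)) S] {j : S → N}
    (h : IsIntegralSubmanifoldOf m D j) (Φ : Diffeomorph (𝓡 d) (𝓡 d) N N ∞) :
    IsIntegralSubmanifoldOf m (pushforwardDistribution Φ D) (Φ ∘ j) := by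
  have hd : ∀ s, mfderiv (𝓡 m) (𝓡 d) (Φ ∘ j) s =
      (mfderiv (𝓡 d) (𝓡 d) Φ (j s)).comp (mfderiv (𝓡 m) (𝓡 d) j s) := fun s =>
    mfderiv_comp s (Φ.mdifferentiable (by simp) _) (h.smooth.mdifferentiable (by simp) s)
  refine ⟨Φ.contMDiff.comp h.smooth, Φ.injective.comp h.injective, fun s => ?_, fun s => ?_⟩
  · rw [hd]
    exact (diffeoTangent Φ (j s)).injective.comp (h.immersion s)
  · rw [hd, comp_apply, pushforwardDistribution_apply_image, ← h.tangent s]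
    exact LinearMap.range_comp _ _

theorem MVField.IsIntegralSubmanifold.pushforward {X : MVField d N m}
    {S : Type*} [TopologicalSpace S] [ChartedSpace (EuclideanSpace ℝ (Fin m)) S] {j : S → N}
    (h : X.IsIntegralSubmanifold j) (Φ : Diffeomorph (𝓡 d) (𝓡 d) N N ∞) :
    (X.pushforward Φ).IsIntegralSubmanifold (Φ ∘ j) := by
  obtain ⟨D, hD, hj⟩ := h
  exact ⟨_, hD.pushforward Φ, hj.pushforward Φ⟩

theorem IsIntegrableDistribution.pushforward
    {D : ∀ p : N, Submodule ℝ (TangentSpace (𝓡 d) p)} (h : IsIntegrableDistribution m D)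
    (Φ : Diffeomorph (𝓡 d) (𝓡 d) N N ∞) :
    IsIntegrableDistribution m (pushforwardDistribution Φ D) := by
  intro q
  obtain ⟨S, i₁, i₂, i₃, i₄, i₅, j, hj, s, hs⟩ := h (Φ.symm q)
  exact ⟨S, i₁, i₂, i₃, i₄, i₅, Φ ∘ j, hj.pushforward Φ, s, by simp [hs]⟩

theorem MVField.IsLocallyDecomposable.pushforward [IsManifold (𝓡 d) ∞ N]
    {X : MVField d N m} (h : X.IsLocallyDecomposable) (Φ : Diffeomorph (𝓡 d) (𝓡 d) N N ∞) :
    (X.pushforward Φ).IsLocallyDecomposable := by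
  intro q
  obtain ⟨U, hU, hqU, Y, hY, hXY⟩ := h (Φ.symm q)
  refine ⟨Φ.symm ⁻¹' U, hU.preimage Φ.symm.continuous, hqU,
    fun i q => (mfderiv (𝓡 d) (𝓡 d) Φ (Φ.symm q) :
      TangentSpace (𝓡 d) (Φ.symm q) →L[ℝ] TangentSpace (𝓡 d) q) (Y i (Φ.symm q)),
    fun i => ?_, fun q hq => ?_⟩
  -- The pushed field is the composite `TΦ ∘ Y i ∘ Φ⁻¹` of smooth maps, up to replacing the base
  -- point `Φ (Φ.symm q)` by `q`.
  · have hT : ContMDiff (𝓡 d).tangent (𝓡 d).tangent ∞ (tangentMap (𝓡 d) (𝓡 d) Φ) :=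
      Φ.contMDiff.contMDiff_tangentMap (by simp)
    refine ((hT.comp_contMDiffOn (hY i)).comp Φ.symm.contMDiff.contMDiffOn
      (fun _ hx => hx)).congr fun q _ => ?_
    have key : ∀ q' : N, q' = q → ∀ v : EuclideanSpace ℝ (Fin d),
        (⟨q, v⟩ : TangentBundle (𝓡 d) N) = ⟨q', v⟩ := by
      rintro _ rfl _
      rfl
    exact key _ (Φ.apply_symm_apply q) _
  · change exteriorPower.map m _ (X (Φ.symm q)) = _
    rw [hXY _ hq, exteriorPower.map_apply_ιMulti]
    rfl

theorem MVField.IsIntegrable.pushforward [IsManifold (𝓡 d) ∞ N] {X : MVField d N m}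
    (h : X.IsIntegrable) (Φ : Diffeomorph (𝓡 d) (𝓡 d) N N ∞) :
    (X.pushforward Φ).IsIntegrable := by
  obtain ⟨D, hD, hI⟩ := h.integrable
  exact ⟨MVField.pushforward_ne_zero h.ne_zero Φ, h.decomposable.pushforward Φ,
    _, hD.pushforward Φ, hI.pushforward Φ⟩

end Pushforward

/-! ### Compatibility with the fibre bundle -/

section Bundle

variable {m d : ℕ} {B : Type*} [TopologicalSpace B] [ChartedSpace (EuclideanSpace ℝ (Fin m)) B]
  {N : Type*} [TopologicalSpace N] [ChartedSpace (EuclideanSpace ℝ (Fin d)) N]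
  {κ : N → B} {Φ : Diffeomorph (𝓡 d) (𝓡 d) N N ∞}
  {φ : Diffeomorph (𝓡 m) (𝓡 m) B B ∞}

/-- At a point, decomposability reduces the contraction to the value of `η` on the projected factors
`Tκ(Y i)`. Pushing `X` forward replaces these by their images under the isomorphism `Tφ`. -/
theorem contractTop_pullback_pushforward_ne_zero [IsManifold (𝓡 d) ∞ N]
    (hκ : ContMDiff (𝓡 d) (𝓡 m) ∞ κ) (hφ : φ ∘ κ = κ ∘ Φ)
    {η : Form m B m} (hη : ∀ b, η b ≠ 0) {X : MVField d N m} (hX : X.IsLocallyDecomposable)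
    (h : ∀ p, contractTop (η.pullback κ p).toAlternatingMap (X p) ≠ 0) (q : N) :
    contractTop (η.pullback κ q).toAlternatingMap (X.pushforward Φ q) ≠ 0 := by
  obtain ⟨p, rfl⟩ : ∃ p, Φ p = q := ⟨Φ.symm q, Φ.apply_symm_apply q⟩
  obtain ⟨U, -, hpU, Y, -, hY⟩ := hX p
  have hp := h p
  rw [hY p hpU, contractTop_ιMulti] at hp
  rw [MVField.pushforward_apply_image, hY p hpU, exteriorPower.map_apply_ιMulti,
    contractTop_ιMulti]
  have hderiv : (mfderiv (𝓡 d) (𝓡 m) κ (Φ p)).comp (mfderiv (𝓡 d) (𝓡 d) Φ p) =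
      (mfderiv (𝓡 m) (𝓡 m) φ (κ p)).comp (mfderiv (𝓡 d) (𝓡 m) κ p) := by
    rw [← mfderiv_comp p (hκ.mdifferentiable (by simp) _) (Φ.mdifferentiable (by simp) p),
      ← mfderiv_comp p (φ.mdifferentiable (by simp) _) (hκ.mdifferentiable (by simp) p), hφ]
  have hβ : (η (κ (Φ p))).toAlternatingMap ≠ 0 := fun h0 =>
    hη _ (ContinuousAlternatingMap.toAlternatingMap_injective h0)
  -- The form `β` is `η` at `κ (Φ p)`, while `Tφ` lands at `φ (κ p)`; both tangent spaces unfold to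
  -- the model space.
  have main := alternatingMap_ne_zero_of_ne_zero
    (V := TangentSpace (𝓡 m) (κ p)) (W := TangentSpace (𝓡 m) (φ (κ p)))
    finrank_euclideanSpace_fin finrank_euclideanSpace_fin
    (diffeoTangent φ (κ p)) (α := (η (κ p)).toAlternatingMap) hβ
    (v := fun i => mfderiv (𝓡 d) (𝓡 m) κ p (Y i.rev p)) hp
  convert main using 1
  change η (κ (Φ p)) _ = η (κ (Φ p)) _
  congr 1
  funext i
  exact DFunLike.congr_fun hderiv (Y i.rev p)

theorem IsIntegralSection.pushforward {X : MVField d N m} {U : Set B} {ψ : B → N}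
    (h : IsIntegralSection κ X U ψ) (hφ : φ ∘ κ = κ ∘ Φ) :
    IsIntegralSection κ (X.pushforward Φ) (φ '' U) (Φ ∘ ψ ∘ φ.symm) := by
  obtain ⟨hU, hψ, hsec, D, hD, hT⟩ := h
  refine ⟨φ.toHomeomorph.isOpenMap U hU, ?_, ?_, _, hD.pushforward Φ, ?_⟩
  · refine Φ.contMDiff.comp_contMDiffOn (hψ.comp φ.symm.contMDiff.contMDiffOn ?_)
    rintro _ ⟨x, hx, rfl⟩
    simpa using hx
  · rintro _ ⟨x, hx, rfl⟩
    have := congrFun hφ (ψ x)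
    simp only [comp_apply, hsec x hx] at this
    simp [← this]
  · rintro y ⟨x, hx, hxy⟩
    -- Eliminating `x` rather than `y` keeps the derivative of `ψ` at the literal point `φ.symm y`
    -- given by the chain rule.
    obtain rfl : x = φ.symm y := by simp [← hxy]
    have h1 : MDifferentiableAt (𝓡 m) (𝓡 d) ψ (φ.symm y) :=
      (hψ.contMDiffAt (hU.mem_nhds hx)).mdifferentiableAt (by simp)
    have h2 : MDifferentiableAt (𝓡 m) (𝓡 m) φ.symm y := φ.symm.mdifferentiable (by simp) y
    -- Reparametrising by `φ⁻¹` leaves the tangent space of the image unchanged because `Tφ⁻¹` is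
    -- onto.
    have hsurj : LinearMap.range (mfderiv (𝓡 m) (𝓡 m) φ.symm y).toLinearMap = ⊤ :=
      LinearEquiv.range (φ.symm.mfderivToContinuousLinearEquiv (by simp) y).toLinearEquiv
    rw [mfderiv_comp y (Φ.mdifferentiable (by simp) _) (h1.comp y h2), mfderiv_comp y h1 h2,
      comp_apply, comp_apply, pushforwardDistribution_apply_image, ← hT _ hx]
    refine (LinearMap.range_comp _ _).trans ?_
    congr 1
    exact LinearMap.range_comp_of_range_eq_top _ hsurj

end Bundle

end Multisymplectic

open Multisymplectic in
theorem mainTheorem6 {m n : ℕ} (hm : 1 ≤ m)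
    -- the base manifold, with its volume form
    {B : Type*} [TopologicalSpace B] [ChartedSpace (EuclideanSpace ℝ (Fin m)) B]
    [IsManifold (𝓡 m) ∞ B] [T2Space B] [SecondCountableTopology B]
    (η : Form m B m) (hη : IsVolumeForm η)
    -- the total manifold, a smooth fibre bundle over the base
    {N : Type*} [TopologicalSpace N] [ChartedSpace (EuclideanSpace ℝ (Fin (n + m))) N]
    [IsManifold (𝓡 (n + m)) ∞ N] [T2Space N] [SecondCountableTopology N]
    {F : Type*} [TopologicalSpace F] [ChartedSpace (EuclideanSpace ℝ (Fin n)) F]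
    [IsManifold (𝓡 n) ∞ F]
    (κ : N → B) (hκ : IsSmoothFiberBundle (m := m) (d := n + m) (n := n) F κ)
    -- the (pre)multisymplectic form and a symmetry
    (Ω : Form (n + m) N (m + 1)) (hΩ : IsPremultisymplecticForm Ω)
    (Φ : Diffeomorph (𝓡 (n + m)) (𝓡 (n + m)) N N ∞) (hΦ : IsSymmetry Ω Φ) :
    (∀ X ∈ kerMV Ω, X.IsIntegrable →
      X.pushforward Φ ∈ kerMV Ω ∧ (X.pushforward Φ).IsIntegrable ∧
      ∀ {S : Type*} [TopologicalSpace S] [ChartedSpace (EuclideanSpace ℝ (Fin m)) S]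
        [IsManifold (𝓡 m) ∞ S] [T2Space S] [SecondCountableTopology S] (j : S → N),
        X.IsIntegralSubmanifold j → (X.pushforward Φ).IsIntegralSubmanifold (Φ ∘ j)) ∧
    (∀ φ : Diffeomorph (𝓡 m) (𝓡 m) B B ∞, φ ∘ κ = κ ∘ Φ →
      (∀ X ∈ kerMVIntegrable Ω (η.pullback κ),
        X.pushforward Φ ∈ kerMVIntegrable Ω (η.pullback κ) ∧
        ∀ (U : Set B) (ψ : B → N), IsIntegralSection κ X U ψ →
          IsIntegralSection κ (X.pushforward Φ) (φ '' U) (Φ ∘ ψ ∘ φ.symm)) ∧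
      ∀ (U : Set B) (ψ : B → N), IsSolutionSection κ Ω (η.pullback κ) U ψ →
        IsSolutionSection κ Ω (η.pullback κ) (φ '' U) (Φ ∘ ψ ∘ φ.symm)) := by

  have hker : ∀ X ∈ kerMV Ω, X.pushforward Φ ∈ kerMV Ω := fun X hX => hΦ ⟨X, hX, rfl⟩
  have hkerI : ∀ φ : Diffeomorph (𝓡 m) (𝓡 m) B B ∞, φ ∘ κ = κ ∘ Φ →
      ∀ X ∈ kerMVIntegrable Ω (η.pullback κ),
        X.pushforward Φ ∈ kerMVIntegrable Ω (η.pullback κ) := fun φ hφ X hX =>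
    ⟨hker X hX.1, contractTop_pullback_pushforward_ne_zero hκ.smooth hφ hη.ne_zero
      hX.2.2.decomposable hX.2.1, hX.2.2.pushforward Φ⟩
  refine ⟨fun X hX hI => ⟨hker X hX, hI.pushforward Φ, fun j hj => hj.pushforward Φ⟩,
    fun φ hφ => ⟨fun X hX => ⟨hkerI φ hφ X hX, fun U ψ hψ => hψ.pushforward hφ⟩, ?_⟩⟩
  rintro U ψ ⟨X, hX, hψ⟩
  -- The multivector field witnessing the new solution section is `Φ_*X`.
  exact ⟨_, hkerI φ hφ X hX, hψ.pushforward hφ⟩
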